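/- **Instance.** Let $G=(V,E,l)$ be a finite undirected graph with edge lengths $l\ge 0$, let $V=V_1\sqcup\dots\sqcup V_m$ be a partition of the vertices, one class for each of $m$ robots, with depots $s_k\in V_k$ and budgets $B_k\ge 0$. A *tour* of robot $k$ is a closed walk $T$ in $G$ based at $s_k$, with vertex set $V(T)$ and length $\ell(T)$; only tours with $V(T)\subseteq V_k$ are admitted. Given $W_1,\dots,W_n\subseteq V$, decay parameters $\gamma_1,\dots,\gamma_q\in(0,1]$ and weights $w_{i,j}\ge0$, the reward of $S\subseteq V$ is $$R(S)=\sum_{i=1}^n\sum_{j=1}^q w_{i,j}\sum_{a=1}^{|W_i\cap S|}\gamma_j^{a-1}.$$ The generalized team orienteering problem (GTOP) asks for tours $T_1,\dots,T_m$ with $V(T_k)\subseteq V_k$ and $\ell(T_k)\le B_k$ that maximize $R(\bigcup_k V(T_k))$. For visit counts $\psi\in\mathbb N^n$ let $$R_\psi(S)=\sum_{i,j}w_{i,j}\sum_{a=\psi_i+1}^{\psi_i+|W_i\cap S|}\gamma_j^{a-1}.$$ **Sequential algorithm.** Start with $\psi=0$. For $k=1,\dots,m$, let $T_k$ be a tour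 returned by a single-robot subroutine called with $(k,\psi)$; then replace $\psi_i$ by $\psi_i+|W_i\cap V(T_k)|$ for every $i$. Return $(T_1,\dots,T_m)$. **Bi-criterion guarantees.** Let $U,b\in\mathbb R^m$. A subroutine is *$\eta$-bi-criterion for $(U,b)$* if for all $k,\psi$ every tour $T$ it returns satisfies $V(T)\subseteq V_k$, $\ell(T)\le U_k$, and $R_\psi(V(T'))\le\eta R_\psi(V(T))$ for all tours $T'$ of robot $k$ with $V(T')\subseteq V_k$ and $\ell(T')\le b_k$. A family $(T_k)$ is a *$\rho$-bi-criterion solution of the GTOP for $(U,b)$* if $V(T_k)\subseteq V_k$ and $\ell(T_k)\le U_k$ for all $k$, and $R(\bigcup_kV(T'_k))\le\rho R(\bigcup_kV(T_k))$ for all families of tours with $V(T'_k)\subseteq V_k$ and $\ell(T'_k)\le b_k$ for all $k$. **Single-robot algorithm (generalized cost-benefit greedy).** Let $N_k$ be the set of vertices that can be reached from $s_k$ inside $V_k$. A route planner assigns to each $X\subseteq N_k$ a tour inside $V_k$ visiting all of $X$; let $\hat c_k(X)$ be its length. On input $(k,\psi)$, let $a$ maximize $R_\psi(\{x\})$ over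 the $x\in N_k$ with $\hat c_k(\{x\})\le B_k$. Starting from $G=\emptyset$ and $C=N_k$, while $C\ne\emptyset$, choose $x\in C$ of largest ratio of marginal reward $R_\psi(G\cup\{x\})-R_\psi(G)$ to marginal cost $\hat c_k(G\cup\{x\})-\hat c_k(G)$ (ratios being compared by cross-multiplication), add it to $G$ if $\hat c_k(G\cup\{x\})\le B_k$, and remove it from $C$. Return the planned route of whichever of $\{a\}$ and $G$ has the larger $R_\psi$. Ties are broken arbitrarily. The planner *has parameters* $(\Psi_k,\alpha_k,\delta_k)$, where $\Psi_k\ge1$, $0<\alpha_k\le1$, $0\le\delta_k\le1$, if $\hat c_k(X)\le\Psi_k\,\ell(T)$ for each $X\subseteq N_k$ and each tour $T$ of robot $k$ inside $V_k$ visiting $X$, and if $$\delta_k\,\hat c_k(\{x\})\le\hat c_k(X\cup\{x\})-\hat c_k(X)\le\alpha_k^{-1}\hat c_k(\{x\})\qquad\text{for all }X\subseteq N_k,\ x\in N_k\setminus X.$$ Let $K_k$ be the largest number of vertices of $N_k$ visited by a tour of robot $k$ inside $V_k$ of length at most $B_k$, and let $$b_k=\frac{\alpha_k\,(1+(K_k-1)\delta_k)}{\Psi_k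 K_k}\,B_k .$$ **Theorem.** Let $\eta=2(1-\tfrac1e)^{-1}$. 1. For all route planners with parameters $(\Psi_k,\alpha_k,\delta_k)$, $k=1,\dots,m$, the cost-benefit algorithm is $\eta$-bi-criterion for $(B,b)$; the sequential algorithm with this subroutine has an output; and every output is a $(1+\eta)$-bi-criterion solution of the GTOP for $(B,b)$. 2. Every robot has a route planner with parameters $(1,1,0)$, for which $b_k=B_k/K_k$. 3. More generally, for every subroutine that is $\eta$-bi-criterion for some $(U,b)\in\mathbb R^m\times\mathbb R^m$, every output of the sequential algorithm is a $(1+\eta)$-bi-criterion solution of the GTOP for $(U,b)$. -/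

import Mathlib

/-- The data of a generalized team orienteering problem with `m` robots, `n` vertex subsets
`W i` and `q` decay parameters. The partition `V₁, …, V_m` of the vertices is given by the map
`owner` sending a vertex to the index of its class. Every robot has its own (copy of the) depot
in its class. Only the values of `len` on edges of the graph matter. -/
structure GTOP (V : Type*) [Fintype V] [DecidableEq V] (m n q : ℕ) where
  graph : SimpleGraph V
  len : Sym2 V → ℝ
  len_nonneg : ∀ e ∈ graph.edgeSet, 0 ≤ len e
  owner : V → Fin m
  depot : Fin m → V
  owner_depot : ∀ k, owner (depot k) = k
  budget : Fin m → ℝ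
  budget_nonneg : ∀ k, 0 ≤ budget k
  W : Fin n → Finset V
  decay : Fin q → ℝ
  decay_pos : ∀ j, 0 < decay j
  decay_le_one : ∀ j, decay j ≤ 1
  weight : Fin n → Fin q → ℝ
  weight_nonneg : ∀ i j, 0 ≤ weight i j

namespace GTOP

variable {V : Type*} [Fintype V] [DecidableEq V] {m n q : ℕ}

/-- A tour of robot `k`: a closed walk in the graph based at its depot. -/
abbrev Tour (I : GTOP V m n q) (k : Fin m) : Type _ :=
  I.graph.Walk (I.depot k) (I.depot k)

/-- The vertex set `V(T)` of a tour. -/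
def verts (I : GTOP V m n q) {k : Fin m} (T : I.Tour k) : Finset V :=
  T.support.toFinset

/-- The length of a tour. -/
def tourLength (I : GTOP V m n q) {k : Fin m} (T : I.Tour k) : ℝ :=
  (T.edges.map I.len).sum

/-- `T` only visits vertices of the class `V_k`. -/
def InRegion (I : GTOP V m n q) {k : Fin m} (T : I.Tour k) : Prop :=
  ∀ v ∈ I.verts T, I.owner v = k

/-- The basis function `∑_{α = 1}^{c} γ ^ (α - 1)` of a visit count `c`. -/
noncomputable def basisFn (γ : ℝ) (c : ℕ) : ℝ :=
  ∑ a ∈ Finset.Icc 1 c, γ ^ (a - 1)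

/-- The reward of a set of visited vertices. -/
noncomputable def reward (I : GTOP V m n q) (S : Finset V) : ℝ :=
  ∑ i, ∑ j, I.weight i j * basisFn (I.decay j) (I.W i ∩ S).card

/-- The reward collected by visiting `S` when `W i` has already been visited `ψ i` times. -/
noncomputable def residual (I : GTOP V m n q) (ψ : Fin n → ℕ) (S : Finset V) : ℝ :=
  ∑ i, ∑ j, I.weight i j *
    (basisFn (I.decay j) (ψ i + (I.W i ∩ S).card) - basisFn (I.decay j) (ψ i))

/-- The set of all vertices visited by a family of tours, one per robot. -/
def teamVerts (I : GTOP V m n q) (T : ∀ k, I.Tour k) : Finset V :=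
  Finset.univ.biUnion fun k => I.verts (T k)

/-! ### The sequential algorithm -/

/-- The visit counts after the first `k` iterations, when the tours chosen are `T`. -/
def visitCounts (I : GTOP V m n q) (T : ∀ k, I.Tour k) : ℕ → Fin n → ℕ
  | 0 => fun _ => 0
  | k + 1 => fun i =>
      visitCounts I T k i + if h : k < m then (I.W i ∩ I.verts (T ⟨k, h⟩)).card else 0

/-- `T` is a possible output of the sequential algorithm whose single-robot subroutine, called
for robot `k` with visit counts `ψ`, may return exactly the tours `t` with `S k ψ t`. -/
def IsSequentialOutput (I : GTOP V m n q) (S : ∀ k, (Fin n → ℕ) → I.Tour k → Prop)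
    (T : ∀ k, I.Tour k) : Prop :=
  ∀ k : Fin m, S k (I.visitCounts T k) (T k)

/-- Single-robot bi-criterion guarantee with reward factor `η`: the tours returned for robot `k`
have length at most `U k`, and `η` times their (residual) reward is at least the reward of every
tour of length at most `b k`. -/
def IsBicriterionSingle (I : GTOP V m n q) (η : ℝ) (U b : Fin m → ℝ)
    (S : ∀ k, (Fin n → ℕ) → I.Tour k → Prop) : Prop :=
  ∀ (k : Fin m) (ψ : Fin n → ℕ) (t : I.Tour k), S k ψ t →
    I.InRegion t ∧ I.tourLength t ≤ U k ∧
      ∀ t' : I.Tour k, I.InRegion t' → I.tourLength t' ≤ b k →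
        I.residual ψ (I.verts t') ≤ η * I.residual ψ (I.verts t)

/-- Team bi-criterion guarantee with reward factor `η`. -/
def IsBicriterionTeam (I : GTOP V m n q) (η : ℝ) (U b : Fin m → ℝ)
    (T : ∀ k, I.Tour k) : Prop :=
  (∀ k, I.InRegion (T k) ∧ I.tourLength (T k) ≤ U k) ∧
    ∀ T' : ∀ k, I.Tour k, (∀ k, I.InRegion (T' k) ∧ I.tourLength (T' k) ≤ b k) →
      I.reward (I.teamVerts T') ≤ η * I.reward (I.teamVerts T)

/-! ### The generalized cost-benefit greedy algorithm for a single robot -/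

open scoped Classical in
/-- The vertices that robot `k` can reach from its depot inside its class. -/
noncomputable def ground (I : GTOP V m n q) (k : Fin m) : Finset V :=
  Finset.univ.filter fun v =>
    ∃ p : I.graph.Walk (I.depot k) v, ∀ u ∈ p.support, I.owner u = k

/-- A route planner for robot `k`: it returns, for each set of reachable vertices, a tour of
robot `k` that visits all of them. -/
structure RoutePlanner (I : GTOP V m n q) (k : Fin m) where
  route : Finset V → I.Tour k
  inRegion : ∀ X ⊆ I.ground k, I.InRegion (route X)
  covers : ∀ X ⊆ I.ground k, X ⊆ I.verts (route X)

/-- The (approximate) cost of visiting `X`: the length of the planned route. -/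
def RoutePlanner.cost {I : GTOP V m n q} {k : Fin m} (P : I.RoutePlanner k)
    (X : Finset V) : ℝ :=
  I.tourLength (P.route X)

/-- `P` is a `ψ`-approximate planner, and every marginal cost
`cost (X ∪ {x}) - cost X` lies between `δ * cost {x}` and `α⁻¹ * cost {x}`. -/
structure RoutePlanner.HasParams {I : GTOP V m n q} {k : Fin m} (P : I.RoutePlanner k)
    (ψ α δ : ℝ) : Prop where
  one_le : 1 ≤ ψ
  alpha_pos : 0 < α
  alpha_le_one : α ≤ 1
  delta_nonneg : 0 ≤ δ
  delta_le_one : δ ≤ 1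
  approx : ∀ X ⊆ I.ground k, ∀ t : I.Tour k, I.InRegion t → X ⊆ I.verts t →
    P.cost X ≤ ψ * I.tourLength t
  lower : ∀ X ⊆ I.ground k, ∀ x ∈ I.ground k, x ∉ X →
    δ * P.cost {x} ≤ P.cost (insert x X) - P.cost X
  upper : ∀ X ⊆ I.ground k, ∀ x ∈ I.ground k, x ∉ X →
    α * (P.cost (insert x X) - P.cost X) ≤ P.cost {x}

open scoped Classical in
/-- The largest number of vertices that robot `k` can visit within its budget. -/
noncomputable def maxVisits (I : GTOP V m n q) (k : Fin m) : ℕ :=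
  ((I.ground k).powerset.filter fun X =>
    ∃ t : I.Tour k, I.InRegion t ∧ X ⊆ I.verts t ∧ I.tourLength t ≤ I.budget k).sup
      Finset.card

/-- `x ∈ C` maximizes the ratio of marginal gain to marginal cost with respect to `G`; the
comparison is cross-multiplied, so that marginal costs may vanish. -/
def IsBestRatio (f c : Finset V → ℝ) (G C : Finset V) (x : V) : Prop :=
  x ∈ C ∧ ∀ y ∈ C,
    (f (insert y G) - f G) * (c (insert x G) - c G) ≤
      (f (insert x G) - f G) * (c (insert y G) - c G)

/-- `GreedyLoop f c B G C H`: the cost-benefit greedy loop for the function `f`, cost `c` and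
budget `B`, run from the current set `G` and the remaining candidates `C`, may end with `H`.
In each iteration a candidate of best ratio is removed from `C`; it is put into `G` if the
budget allows it. -/
inductive GreedyLoop (f c : Finset V → ℝ) (B : ℝ) :
    Finset V → Finset V → Finset V → Prop where
  | done (G : Finset V) : GreedyLoop f c B G ∅ G
  | take (G C H : Finset V) (x : V) (hx : IsBestRatio f c G C x)
      (hB : c (insert x G) ≤ B) (h : GreedyLoop f c B (insert x G) (C.erase x) H) :
      GreedyLoop f c B G C H
  | skip (G C H : Finset V) (x : V) (hx : IsBestRatio f c G C x)
      (hB : B < c (insert x G)) (h : GreedyLoop f c B G (C.erase x) H) :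
      GreedyLoop f c B G C H

/-- The possible outputs, for robot `k` and visit counts `ψ`, of the generalized cost-benefit
algorithm: the planned route of the better of the best affordable single vertex `a` and the set
`G` built by the greedy loop. -/
def CostBenefit (I : GTOP V m n q) (P : ∀ k, I.RoutePlanner k) (k : Fin m) (ψ : Fin n → ℕ)
    (t : I.Tour k) : Prop :=
  ∃ (a : V) (G S : Finset V),
    (a ∈ I.ground k ∧ (P k).cost {a} ≤ I.budget k ∧
      ∀ b ∈ I.ground k, (P k).cost {b} ≤ I.budget k →
        I.residual ψ {b} ≤ I.residual ψ {a}) ∧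
    GreedyLoop (I.residual ψ) (P k).cost (I.budget k) ∅ (I.ground k) G ∧
    (S = {a} ∨ S = G) ∧ I.residual ψ {a} ≤ I.residual ψ S ∧
    I.residual ψ G ≤ I.residual ψ S ∧ t = (P k).route S

/-- The reduced budget against which the cost-benefit algorithm is compared. -/
noncomputable def reducedBudget (I : GTOP V m n q) (ψ α δ : Fin m → ℝ) (k : Fin m) : ℝ :=
  α k * (1 + ((I.maxVisits k : ℝ) - 1) * δ k) / (ψ k * (I.maxVisits k : ℝ)) * I.budget k

end GTOP

/-- The factor `η = 2 (1 - 1/e)⁻¹`. -/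
noncomputable def orienteeringFactor : ℝ := 2 * (1 - 1 / Real.exp 1)⁻¹

namespace GTOP

variable {V : Type*} [Fintype V] [DecidableEq V] {m n q : ℕ}

/-! ### Concavity of the basis functions -/

/-! Everything rests on concavity of the basis functions: a visit is worth less when the count is
already higher. Hence residual rewards are monotone and submodular.

Team bound. Let `T` be sequential and `T'` a competitor. Adding all of `T'` on top of `T` gains at
most the sum of the residual rewards of the `T' k`, each measured at the counts robot `k` saw, since
those are below the final counts (`reward_teamVerts_le`). Each summand is at most `η` times the
residual reward of `T k`. The classes being disjoint, these residuals telescope to the reward of `T`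
(`reward_teamVerts_eq`), whence `1 + η`.

Single robot. Let `O` be the vertices of a competing tour. The reduced budget is chosen so that the
single-vertex costs over `O` add up to at most `α * B` (`sum_cost_verts_le`); by the upper bound on
marginal costs, the marginal costs of `O` over any `G` then add up to at most `B`. So the best ratio
is at least (gap to `f O`) / `B`, and the gap decays like `exp (-cost / B)` (`gap_insert_le`). Once
a vertex `x` of `O` is rejected, cost `B` would have been exceeded, so `G` and `{x}` together earn
`(1 - 1/e) f O`; the better of the greedy set and the best single vertex earns half of that.

Optimal planners exist because a shortest covering tour exists, although there are infinitely many
tours. -/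

theorem basisFn_zero (γ : ℝ) : basisFn γ 0 = 0 := by simp [basisFn]

theorem basisFn_succ (γ : ℝ) (c : ℕ) : basisFn γ (c + 1) = basisFn γ c + γ ^ c := by
  simp [basisFn, Finset.sum_Icc_succ_top]

theorem basisFn_mono {γ : ℝ} (h0 : 0 < γ) : Monotone (basisFn γ) :=
  monotone_nat_of_le_succ fun c => by
    rw [basisFn_succ]
    linarith [pow_pos h0 c]

theorem basisFn_concave {γ : ℝ} (h0 : 0 < γ) (h1 : γ ≤ 1) {p r : ℕ} (hpr : p ≤ r) (d : ℕ) :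
    basisFn γ (r + d) - basisFn γ r ≤ basisFn γ (p + d) - basisFn γ p := by
  induction d with
  | zero => simp
  | succ d ih =>
    have := pow_le_pow_of_le_one h0.le h1 (Nat.add_le_add_right hpr d)
    rw [← add_assoc, ← add_assoc, basisFn_succ, basisFn_succ]
    linarith

/-- Each increment, stacked on a count of at least `r`, gains no more than it would from its own
lower base `p k`. Distinct bases serve the team bound, a constant base serves submodularity. -/
theorem basisFn_add_sum_le {γ : ℝ} (h0 : 0 < γ) (h1 : γ ≤ 1) {ι : Type*} (s : Finset ι)
    (r : ℕ) (p d : ι → ℕ) (hp : ∀ k ∈ s, p k ≤ r) :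
    basisFn γ (r + ∑ k ∈ s, d k) ≤
      basisFn γ r + ∑ k ∈ s, (basisFn γ (p k + d k) - basisFn γ (p k)) := by
  classical
  induction s using Finset.induction_on with
  | empty => simp
  | insert a s ha ih =>
    rw [Finset.sum_insert ha, Finset.sum_insert ha]
    have h := ih fun k hk => hp k (Finset.mem_insert_of_mem hk)
    have h2 := basisFn_concave h0 h1
      ((hp a (Finset.mem_insert_self a s)).trans (Nat.le_add_right r (∑ k ∈ s, d k))) (d a)
    rw [add_comm (d a), ← add_assoc]
    linarith

/-! ### The residual reward is monotone and submodular -/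

theorem residual_empty (I : GTOP V m n q) (ψ : Fin n → ℕ) : I.residual ψ ∅ = 0 := by
  simp [residual]

theorem residual_mono (I : GTOP V m n q) (ψ : Fin n → ℕ) : Monotone (I.residual ψ) := by
  intro S T h
  refine Finset.sum_le_sum fun i _ => Finset.sum_le_sum fun j _ =>
    mul_le_mul_of_nonneg_left (sub_le_sub_right ?_ _) (I.weight_nonneg i j)
  exact basisFn_mono (I.decay_pos j)
    (Nat.add_le_add_left (Finset.card_le_card (Finset.inter_subset_inter_left h)) _)

theorem residual_insert_le (I : GTOP V m n q) (ψ : Fin n → ℕ) (G : Finset V) (x : V) :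
    I.residual ψ (insert x G) ≤ I.residual ψ G + I.residual ψ {x} := by
  simp only [residual, ← Finset.sum_add_distrib, ← mul_add]
  refine Finset.sum_le_sum fun i _ => Finset.sum_le_sum fun j _ =>
    mul_le_mul_of_nonneg_left ?_ (I.weight_nonneg i j)
  have h1 : (I.W i ∩ insert x G).card ≤ (I.W i ∩ G).card + (I.W i ∩ {x}).card := by
    rw [Finset.insert_eq, Finset.inter_union_distrib_left, add_comm]
    exact Finset.card_union_le _ _
  have h2 := basisFn_mono (I.decay_pos j) (Nat.add_le_add_left h1 (ψ i))
  have h3 := basisFn_concave (I.decay_pos j) (I.decay_le_one j)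
    (Nat.le_add_right (ψ i) (I.W i ∩ G).card) (I.W i ∩ {x}).card
  rw [← add_assoc] at h2
  linarith

theorem residual_sub_le_sum (I : GTOP V m n q) (ψ : Fin n → ℕ) (G O : Finset V) :
    I.residual ψ O - I.residual ψ G ≤
      ∑ y ∈ O \ G, (I.residual ψ (insert y G) - I.residual ψ G) := by
  simp only [residual, ← Finset.sum_sub_distrib, ← mul_sub]
  rw [Finset.sum_comm (s := O \ G)]
  refine Finset.sum_le_sum fun i _ => ?_
  rw [Finset.sum_comm (s := O \ G)]
  refine Finset.sum_le_sum fun j _ => ?_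
  rw [← Finset.mul_sum]
  refine mul_le_mul_of_nonneg_left ?_ (I.weight_nonneg i j)
  -- Outside `G` the count splits exactly. Equality is needed, since the marginal gains must be
  -- bounded from below.
  have hins : ∀ y ∈ O \ G,
      (I.W i ∩ insert y G).card = (I.W i ∩ G).card + (I.W i ∩ {y}).card := by
    intro y hy
    rw [Finset.insert_eq, Finset.inter_union_distrib_left, add_comm,
      Finset.card_union_of_disjoint]
    rw [Finset.disjoint_left]
    intro z hz hz'
    simp only [Finset.mem_inter, Finset.mem_singleton, Finset.mem_sdiff] at hz hz' hy
    exact hy.2 (hz.2 ▸ hz'.2)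
  have hcard : (I.W i ∩ O).card ≤ (I.W i ∩ G).card + ∑ y ∈ O \ G, (I.W i ∩ {y}).card := by
    have hsub : I.W i ∩ O ⊆ (I.W i ∩ G) ∪ (O \ G).biUnion fun y => I.W i ∩ {y} := by
      intro z hz
      simp only [Finset.mem_union, Finset.mem_inter, Finset.mem_biUnion, Finset.mem_sdiff,
        Finset.mem_singleton] at hz ⊢
      by_cases hzG : z ∈ G
      · exact Or.inl ⟨hz.1, hzG⟩
      · exact Or.inr ⟨z, ⟨hz.2, hzG⟩, hz.1, rfl⟩
    exact (Finset.card_le_card hsub).trans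
      ((Finset.card_union_le _ _).trans (Nat.add_le_add_left Finset.card_biUnion_le _))
  have h1 := basisFn_mono (I.decay_pos j) (Nat.add_le_add_left hcard (ψ i))
  have h2 := basisFn_add_sum_le (I.decay_pos j) (I.decay_le_one j) (O \ G)
    (ψ i + (I.W i ∩ G).card) (fun _ => ψ i + (I.W i ∩ G).card)
    (fun y => (I.W i ∩ {y}).card) fun _ _ => le_rfl
  have h3 : ∑ y ∈ O \ G, (basisFn (I.decay j) (ψ i + (I.W i ∩ insert y G).card) -
        basisFn (I.decay j) (ψ i) -
        (basisFn (I.decay j) (ψ i + (I.W i ∩ G).card) - basisFn (I.decay j) (ψ i))) =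
      ∑ y ∈ O \ G, (basisFn (I.decay j) (ψ i + (I.W i ∩ G).card + (I.W i ∩ {y}).card) -
        basisFn (I.decay j) (ψ i + (I.W i ∩ G).card)) := by
    refine Finset.sum_congr rfl fun y hy => ?_
    rw [hins y hy, ← add_assoc]
    ring
  rw [h3]
  rw [← add_assoc] at h1
  linarith

/-! ### The sequential algorithm -/

theorem visitCounts_le_succ (I : GTOP V m n q) (T : ∀ k, I.Tour k) (k : ℕ) (i : Fin n) :
    I.visitCounts T k i ≤ I.visitCounts T (k + 1) i :=
  Nat.le_add_right _ _

theorem visitCounts_mono (I : GTOP V m n q) (T : ∀ k, I.Tour k) (i : Fin n) :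
    Monotone fun k => I.visitCounts T k i :=
  monotone_nat_of_le_succ fun k => I.visitCounts_le_succ T k i

theorem visitCounts_succ (I : GTOP V m n q) (T : ∀ k, I.Tour k) (k : Fin m) (i : Fin n) :
    I.visitCounts T (k + 1) i = I.visitCounts T k i + (I.W i ∩ I.verts (T k)).card := by
  simp [visitCounts]

theorem visitCounts_eq_sum (I : GTOP V m n q) (T : ∀ k, I.Tour k) (i : Fin n) :
    I.visitCounts T m i = ∑ k, (I.W i ∩ I.verts (T k)).card := by
  have h : ∀ k, I.visitCounts T k i = ∑ l ∈ Finset.range k,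
      if h : l < m then (I.W i ∩ I.verts (T ⟨l, h⟩)).card else 0 := by
    intro k
    induction k with
    | zero => rfl
    | succ k ih => rw [Finset.sum_range_succ, ← ih]; rfl
  rw [h, Finset.sum_range]
  simp

theorem visitCounts_eq_card (I : GTOP V m n q) (T : ∀ k, I.Tour k)
    (hT : ∀ k, I.InRegion (T k)) (i : Fin n) :
    I.visitCounts T m i = (I.W i ∩ I.teamVerts T).card := by
  rw [visitCounts_eq_sum, teamVerts, Finset.inter_biUnion, Finset.card_biUnion]
  intro k _ l _ hkl
  change Disjoint (I.W i ∩ I.verts (T k)) (I.W i ∩ I.verts (T l))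
  rw [Finset.disjoint_left]
  intro v hv hv'
  exact hkl ((hT k v (Finset.mem_inter.1 hv).2).symm.trans (hT l v (Finset.mem_inter.1 hv').2))

/-- The residuals telescope along the visit counts. The final counts are those of the union because
tours in different classes share no vertex. -/
theorem reward_teamVerts_eq (I : GTOP V m n q) (T : ∀ k, I.Tour k)
    (hT : ∀ k, I.InRegion (T k)) :
    I.reward (I.teamVerts T) =
      ∑ k : Fin m, I.residual (I.visitCounts T k) (I.verts (T k)) := by
  simp only [reward, residual]
  rw [Finset.sum_comm (s := (Finset.univ : Finset (Fin m)))]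
  refine Finset.sum_congr rfl fun i _ => ?_
  rw [Finset.sum_comm (s := (Finset.univ : Finset (Fin m)))]
  refine Finset.sum_congr rfl fun j _ => ?_
  rw [← Finset.mul_sum, ← I.visitCounts_eq_card T hT]
  congr 1
  simp only [← visitCounts_succ]
  rw [Fin.sum_univ_eq_sum_range (fun k => basisFn (I.decay j) (I.visitCounts T (k + 1) i) -
    basisFn (I.decay j) (I.visitCounts T k i)) m,
    Finset.sum_range_sub (fun k => basisFn (I.decay j) (I.visitCounts T k i))]
  simp [visitCounts, basisFn_zero]

/-- The counts seen by robot `k` never exceed the final ones, so concavity charges `T' k` to the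
earlier counts. For `T'` a union bound is enough, so its tours may overlap. -/
theorem reward_teamVerts_le (I : GTOP V m n q) (T T' : ∀ k, I.Tour k)
    (hT : ∀ k, I.InRegion (T k)) :
    I.reward (I.teamVerts T') ≤ I.reward (I.teamVerts T) +
      ∑ k : Fin m, I.residual (I.visitCounts T k) (I.verts (T' k)) := by
  simp only [reward, residual]
  rw [Finset.sum_comm (s := (Finset.univ : Finset (Fin m))), ← Finset.sum_add_distrib]
  refine Finset.sum_le_sum fun i _ => ?_
  rw [Finset.sum_comm (s := (Finset.univ : Finset (Fin m))), ← Finset.sum_add_distrib]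
  refine Finset.sum_le_sum fun j _ => ?_
  rw [← Finset.mul_sum, ← mul_add]
  refine mul_le_mul_of_nonneg_left ?_ (I.weight_nonneg i j)
  have hcard : (I.W i ∩ I.teamVerts T').card ≤
      (I.W i ∩ I.teamVerts T).card + ∑ k, (I.W i ∩ I.verts (T' k)).card := by
    rw [teamVerts, Finset.inter_biUnion]
    exact Finset.card_biUnion_le.trans (Nat.le_add_left _ _)
  refine (basisFn_mono (I.decay_pos j) hcard).trans
    (basisFn_add_sum_le (I.decay_pos j) (I.decay_le_one j) _ _
      (fun k : Fin m => I.visitCounts T k i) _ fun k _ => ?_)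
  rw [← I.visitCounts_eq_card T hT]
  exact I.visitCounts_mono T i k.2.le

theorem isBicriterionTeam_of_single (I : GTOP V m n q) {η : ℝ} {U b : Fin m → ℝ}
    {S : ∀ k, (Fin n → ℕ) → I.Tour k → Prop} (hS : I.IsBicriterionSingle η U b S)
    {T : ∀ k, I.Tour k} (hT : I.IsSequentialOutput S T) :
    I.IsBicriterionTeam (1 + η) U b T := by
  have hreg : ∀ k, I.InRegion (T k) := fun k => (hS k _ _ (hT k)).1
  refine ⟨fun k => ⟨hreg k, (hS k _ _ (hT k)).2.1⟩, fun T' hT' => ?_⟩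
  refine (I.reward_teamVerts_le T T' hreg).trans ?_
  rw [add_mul, one_mul]
  refine add_le_add_right ?_ _
  rw [I.reward_teamVerts_eq T hreg, Finset.mul_sum]
  exact Finset.sum_le_sum fun k _ => (hS k _ _ (hT k)).2.2 (T' k) (hT' k).1 (hT' k).2

theorem visitCounts_congr (I : GTOP V m n q) (T T' : ∀ k, I.Tour k) (k : ℕ)
    (h : ∀ l : Fin m, (l : ℕ) < k → T l = T' l) : I.visitCounts T k = I.visitCounts T' k := by
  induction k with
  | zero => rfl
  | succ k ih =>
    funext i
    simp only [visitCounts]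
    rw [ih fun l hl => h l (hl.trans k.lt_succ_self)]
    congr 1
    split
    · rename_i hk
      rw [h ⟨k, hk⟩ k.lt_succ_self]
    · rfl

/-- The counts before stage `k` depend only on earlier tours, so a valid prefix can be extended by
changing a single entry; later entries are placeholders. -/
theorem exists_isSequentialOutput (I : GTOP V m n q)
    {S : ∀ k, (Fin n → ℕ) → I.Tour k → Prop} (hS : ∀ k ψ, ∃ t, S k ψ t) :
    ∃ T : ∀ k, I.Tour k, I.IsSequentialOutput S T := by
  have h : ∀ r : ℕ, ∃ T : ∀ k, I.Tour k,
      ∀ k : Fin m, (k : ℕ) < r → S k (I.visitCounts T k) (T k) := by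
    intro r
    induction r with
    | zero => exact ⟨fun _ => SimpleGraph.Walk.nil, fun k hk => absurd hk (Nat.not_lt_zero _)⟩
    | succ r ih =>
      obtain ⟨T, hT⟩ := ih
      by_cases hr : r < m
      · obtain ⟨t, ht⟩ := hS ⟨r, hr⟩ (I.visitCounts T r)
        have hne : ∀ l : Fin m, (l : ℕ) < r → Function.update T ⟨r, hr⟩ t l = T l := by
          intro l hl
          exact Function.update_of_ne (fun h => by simp [h] at hl) _ _
        refine ⟨Function.update T ⟨r, hr⟩ t, fun k hk => ?_⟩
        rw [I.visitCounts_congr _ T k fun l hl => hne l (by omega)]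
        rcases Nat.lt_succ_iff_lt_or_eq.1 hk with hk | hk
        · rw [hne k hk]
          exact hT k hk
        · obtain rfl : k = ⟨r, hr⟩ := Fin.ext hk
          rw [Function.update_self]
          exact ht
      · exact ⟨T, fun k _ => hT k (by omega)⟩
  obtain ⟨T, hT⟩ := h m
  exact ⟨T, fun k => hT k k.2⟩

/-! ### Tours and optimal route planners -/

theorem tourLength_nonneg (I : GTOP V m n q) {k : Fin m} (T : I.Tour k) :
    0 ≤ I.tourLength T := by
  refine List.sum_nonneg fun x hx => ?_
  obtain ⟨e, he, rfl⟩ := List.mem_map.1 hx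
  exact I.len_nonneg e (T.edges_subset_edgeSet he)

theorem tourLength_nil (I : GTOP V m n q) (k : Fin m) :
    I.tourLength (SimpleGraph.Walk.nil : I.Tour k) = 0 := by
  simp [tourLength]

theorem inRegion_nil (I : GTOP V m n q) (k : Fin m) :
    I.InRegion (SimpleGraph.Walk.nil : I.Tour k) := by
  simp [InRegion, verts, I.owner_depot]

theorem depot_mem_verts (I : GTOP V m n q) {k : Fin m} (T : I.Tour k) :
    I.depot k ∈ I.verts T := by
  simp [verts]

theorem verts_subset_ground (I : GTOP V m n q) {k : Fin m} {T : I.Tour k}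
    (hT : I.InRegion T) : I.verts T ⊆ I.ground k := by
  intro v hv
  have hv' : v ∈ T.support := List.mem_toFinset.1 hv
  simp only [ground, Finset.mem_filter, Finset.mem_univ, true_and]
  exact ⟨T.takeUntil v hv', fun u hu =>
    hT u (List.mem_toFinset.2 (T.support_takeUntil_subset_support hv' hu))⟩

theorem tourLength_append (I : GTOP V m n q) {k : Fin m} (S T : I.Tour k) :
    I.tourLength (S.append T) = I.tourLength S + I.tourLength T := by
  simp [tourLength]

theorem verts_append (I : GTOP V m n q) {k : Fin m} (S T : I.Tour k) :
    I.verts (S.append T) = I.verts S ∪ I.verts T := by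
  ext v
  simp [verts, SimpleGraph.Walk.mem_support_append_iff]

theorem InRegion.append {I : GTOP V m n q} {k : Fin m} {S T : I.Tour k}
    (hS : I.InRegion S) (hT : I.InRegion T) : I.InRegion (S.append T) := by
  intro v hv
  rw [verts_append, Finset.mem_union] at hv
  exact hv.elim (hS v) (hT v)

theorem exists_tour_covering (I : GTOP V m n q) (k : Fin m) (X : Finset V)
    (hX : X ⊆ I.ground k) : ∃ T : I.Tour k, I.InRegion T ∧ X ⊆ I.verts T := by
  induction X using Finset.induction_on with
  | empty => exact ⟨_, I.inRegion_nil k, Finset.empty_subset _⟩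
  | insert x X _ ih =>
    obtain ⟨T, hT, hXT⟩ := ih ((Finset.subset_insert x X).trans hX)
    have hx := hX (Finset.mem_insert_self x X)
    simp only [ground, Finset.mem_filter, Finset.mem_univ, true_and] at hx
    obtain ⟨p, hp⟩ := hx
    have hreg : I.InRegion (p.append p.reverse : I.Tour k) := by
      intro v hv
      simp only [verts, List.mem_toFinset, SimpleGraph.Walk.mem_support_append_iff,
        SimpleGraph.Walk.support_reverse, List.mem_reverse, or_self] at hv
      exact hp v hv
    refine ⟨T.append (p.append p.reverse), hT.append hreg, ?_⟩
    rw [verts_append]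
    refine Finset.insert_subset (Finset.mem_union_right _ ?_)
      (hXT.trans Finset.subset_union_left)
    simp [verts, SimpleGraph.Walk.mem_support_append_iff]

theorem tourLength_eq_sum_count (I : GTOP V m n q) {k : Fin m} (T : I.Tour k) :
    I.tourLength T = ∑ e, (T.edges.count e : ℝ) * I.len e := by
  rw [tourLength, Finset.sum_list_map_count]
  simp only [nsmul_eq_mul]
  refine Finset.sum_subset (Finset.subset_univ _) fun e _ he => ?_
  rw [List.count_eq_zero.2 fun h => he (List.mem_toFinset.2 h)]
  simp

theorem tourLength_le_of_count_le (I : GTOP V m n q) {k : Fin m} {S T : I.Tour k}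
    (h : ∀ e, S.edges.count e ≤ T.edges.count e) : I.tourLength S ≤ I.tourLength T := by
  rw [tourLength_eq_sum_count, tourLength_eq_sum_count]
  refine Finset.sum_le_sum fun e _ => ?_
  -- Lengths may be negative off the graph, so multiplicities are compared only on edges of `T`;
  -- elsewhere both vanish.
  by_cases he : e ∈ T.edges
  · exact mul_le_mul_of_nonneg_right (Nat.cast_le.2 (h e))
      (I.len_nonneg e (T.edges_subset_edgeSet he))
  · have h0 := List.count_eq_zero.2 he
    have h1 : S.edges.count e = 0 := Nat.le_zero.1 (h0 ▸ h e)
    rw [h0, h1]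

/-- By Dickson's lemma, applied to the edge multiplicities, every nonempty set of tours has a
shortest element. -/
theorem exists_shortest_tour (I : GTOP V m n q) {k : Fin m} (s : Set (I.Tour k))
    (hs : s.Nonempty) : ∃ T ∈ s, ∀ T' ∈ s, I.tourLength T ≤ I.tourLength T' := by
  have hwf : (I.tourLength '' s).IsWF := by
    refine Set.IsPWO.isWF ?_
    intro f
    choose T hT hf using fun i => (f i).2
    obtain ⟨a, b, hab, hle⟩ := wellQuasiOrdered_le
      fun i => (fun e => (T i).edges.count e : Sym2 V → ℕ)
    refine ⟨a, b, hab, ?_⟩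
    change (f a : ℝ) ≤ f b
    rw [← hf a, ← hf b]
    exact I.tourLength_le_of_count_le hle
  obtain ⟨T, hT, hmin⟩ := hwf.min_mem (hs.image _)
  exact ⟨T, hT, fun T' hT' => hmin ▸ hwf.min_le (hs.image _) (Set.mem_image_of_mem _ hT')⟩

theorem exists_routePlanner (I : GTOP V m n q) (k : Fin m) :
    ∃ P : I.RoutePlanner k, P.HasParams 1 1 0 := by
  have h : ∀ X : Finset V, ∃ T : I.Tour k, X ⊆ I.ground k →
      (I.InRegion T ∧ X ⊆ I.verts T) ∧
        ∀ T' : I.Tour k, I.InRegion T' ∧ X ⊆ I.verts T' → I.tourLength T ≤ I.tourLength T' := by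
    intro X
    by_cases hX : X ⊆ I.ground k
    · obtain ⟨T, hT, hmin⟩ := I.exists_shortest_tour
        {T : I.Tour k | I.InRegion T ∧ X ⊆ I.verts T} (I.exists_tour_covering k X hX)
      exact ⟨T, fun _ => ⟨hT, hmin⟩⟩
    · exact ⟨SimpleGraph.Walk.nil, fun h => absurd h hX⟩
  choose R hR using h
  refine ⟨⟨R, fun X hX => (hR X hX).1.1, fun X hX => (hR X hX).1.2⟩, le_rfl, one_pos, le_rfl,
    le_rfl, zero_le_one, ?_, ?_, ?_⟩
  · intro X hX t ht hXt
    rw [one_mul]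
    exact (hR X hX).2 t ⟨ht, hXt⟩
  · intro X hX x hx _
    -- A tour covering the larger set also covers `X`: cost is monotone, which is the lower bound
    -- with `δ = 0`.
    have hins := hR _ (Finset.insert_subset hx hX)
    rw [zero_mul, sub_nonneg]
    exact (hR X hX).2 _ ⟨hins.1.1, (Finset.subset_insert x X).trans hins.1.2⟩
  · intro X hX x hx _
    have h1 := hR X hX
    have h2 := hR {x} (Finset.singleton_subset_iff.2 hx)
    -- Concatenating two tours at the depot gives subadditivity, hence `α = 1`.
    have h3 := (hR _ (Finset.insert_subset hx hX)).2 ((R X).append (R {x}))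
      ⟨h1.1.1.append h2.1.1, by
        rw [verts_append]
        exact Finset.insert_subset (Finset.mem_union_right _ (h2.1.2 (Finset.mem_singleton_self x)))
          (h1.1.2.trans Finset.subset_union_left)⟩
    rw [tourLength_append] at h3
    simp only [RoutePlanner.cost]
    linarith

/-! ### The cost-benefit greedy loop -/

omit [Fintype V] in
theorem GreedyLoop.subset {f c : Finset V → ℝ} {B : ℝ} {G C H : Finset V}
    (h : GreedyLoop f c B G C H) : G ⊆ H := by
  induction h with
  | done G => exact subset_rfl
  | take G C H x _ _ _ ih => exact (Finset.subset_insert x G).trans ih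
  | skip G C H x _ _ _ ih => exact ih

omit [Fintype V] in
theorem GreedyLoop.subset_union {f c : Finset V → ℝ} {B : ℝ} {G C H : Finset V}
    (h : GreedyLoop f c B G C H) : H ⊆ G ∪ C := by
  induction h with
  | done G => simp
  | take G C H x hx _ _ ih =>
    refine ih.trans (Finset.union_subset (Finset.insert_subset ?_ Finset.subset_union_left)
      ((Finset.erase_subset x C).trans Finset.subset_union_right))
    exact Finset.mem_union_right _ hx.1
  | skip G C H x _ _ _ ih =>
    exact ih.trans (Finset.union_subset_union_right (Finset.erase_subset x C))

omit [Fintype V] in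
theorem GreedyLoop.cost_le {f c : Finset V → ℝ} {B : ℝ} {G C H : Finset V}
    (h : GreedyLoop f c B G C H) (hG : c G ≤ B) : c H ≤ B := by
  induction h with
  | done G => exact hG
  | take G C H x _ hB _ ih => exact ih hB
  | skip G C H x _ _ _ ih => exact ih hG

omit [Fintype V] in
theorem exists_isBestRatio {f c : Finset V → ℝ} {G C : Finset V} (hC : C.Nonempty)
    (hf : ∀ x ∈ C, f G ≤ f (insert x G)) (hc : ∀ x ∈ C, c G ≤ c (insert x G)) :
    ∃ x, IsBestRatio f c G C x := by
  by_cases h0 : ∃ x ∈ C, c (insert x G) - c G = 0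
  · obtain ⟨x, hx, hx0⟩ := h0
    -- A candidate of zero marginal cost beats everything after cross-multiplication: the left side
    -- vanishes and the right side is nonnegative.
    refine ⟨x, hx, fun y hy => ?_⟩
    rw [hx0, mul_zero]
    exact mul_nonneg (sub_nonneg.2 (hf x hx)) (sub_nonneg.2 (hc y hy))
  · push Not at h0
    have hpos : ∀ x ∈ C, 0 < c (insert x G) - c G := fun x hx =>
      lt_of_le_of_ne (sub_nonneg.2 (hc x hx)) (h0 x hx).symm
    obtain ⟨x, hx, hmax⟩ := C.exists_max_image
      (fun x => (f (insert x G) - f G) / (c (insert x G) - c G)) hC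
    exact ⟨x, hx, fun y hy => (div_le_div_iff₀ (hpos y hy) (hpos x hx)).1 (hmax y hy)⟩

omit [Fintype V] in
theorem exists_greedyLoop {f c : Finset V → ℝ} {B : ℝ} {N : Finset V} (hf : Monotone f)
    (hc : ∀ X ⊆ N, ∀ x ∈ N, x ∉ X → c X ≤ c (insert x X)) (C : Finset V) :
    ∀ G ⊆ N, C ⊆ N → Disjoint G C → ∃ H, GreedyLoop f c B G C H := by
  induction C using Finset.strongInduction with
  | H C ih =>
    intro G hG hCN hdis
    rcases C.eq_empty_or_nonempty with rfl | hC
    · exact ⟨G, .done G⟩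
    obtain ⟨x, hx⟩ := exists_isBestRatio hC (fun x _ => hf (Finset.subset_insert x G))
      fun x hx => hc G hG x (hCN hx) (Finset.disjoint_right.1 hdis hx)
    have hsub := (Finset.erase_subset x C).trans hCN
    rcases le_or_gt (c (insert x G)) B with hB | hB
    · obtain ⟨H, hH⟩ := ih _ (Finset.erase_ssubset hx.1) (insert x G)
        (Finset.insert_subset (hCN hx.1) hG) hsub
        (Finset.disjoint_insert_left.2 ⟨Finset.notMem_erase x C,
          hdis.mono_right (Finset.erase_subset x C)⟩)
      exact ⟨H, .take G C H x hx hB hH⟩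
    · obtain ⟨H, hH⟩ := ih _ (Finset.erase_ssubset hx.1) G hG hsub
        (hdis.mono_right (Finset.erase_subset x C))
      exact ⟨H, .skip G C H x hx hB hH⟩

omit [Fintype V] in
/-- Adding an element of best ratio lets the gap to `f O` shrink by the factor
`exp (- Δc / B)`. -/
theorem gap_insert_le {f c : Finset V → ℝ} {B : ℝ} {G C O : Finset V} {x : V} (hB : 0 < B)
    (hO : 0 ≤ f O) (hf : f G ≤ f (insert x G)) (hx : IsBestRatio f c G C x) (hOC : O \ G ⊆ C)
    (hsum : f O - f G ≤ ∑ y ∈ O \ G, (f (insert y G) - f G))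
    (hcost : ∑ y ∈ O \ G, (c (insert y G) - c G) ≤ B) (hcx : c G ≤ c (insert x G))
    (hgap : f O - f G ≤ f O * Real.exp (-(c G / B))) :
    f O - f (insert x G) ≤ f O * Real.exp (-(c (insert x G) / B)) := by
  have key : (f O - f G) * (c (insert x G) - c G) ≤ (f (insert x G) - f G) * B := by
    calc (f O - f G) * (c (insert x G) - c G)
        ≤ (∑ y ∈ O \ G, (f (insert y G) - f G)) * (c (insert x G) - c G) :=
          mul_le_mul_of_nonneg_right hsum (sub_nonneg.2 hcx)
      _ ≤ (f (insert x G) - f G) * ∑ y ∈ O \ G, (c (insert y G) - c G) := by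
          rw [Finset.sum_mul, Finset.mul_sum]
          exact Finset.sum_le_sum fun y hy => hx.2 y (hOC hy)
      _ ≤ (f (insert x G) - f G) * B := mul_le_mul_of_nonneg_left hcost (sub_nonneg.2 hf)
  -- The exponential estimate is multiplied by the gap below, so the gap must be nonnegative;
  -- otherwise the claim is trivial.
  rcases le_total (f O) (f G) with hle | hle
  · exact (sub_nonpos.2 (hle.trans hf)).trans (mul_nonneg hO (Real.exp_pos _).le)
  set a := (c (insert x G) - c G) / B with ha
  have h1 : (f O - f G) * a ≤ f (insert x G) - f G := by
    rw [ha, ← mul_div_assoc, div_le_iff₀ hB]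
    exact key
  have h2 : -a + 1 ≤ Real.exp (-a) := Real.add_one_le_exp (-a)
  have h3 : -(c (insert x G) / B) = -(c G / B) + -a := by
    rw [ha, sub_div]
    ring
  calc f O - f (insert x G) ≤ (f O - f G) * (-a + 1) := by linarith
    _ ≤ (f O - f G) * Real.exp (-a) := mul_le_mul_of_nonneg_left h2 (sub_nonneg.2 hle)
    _ ≤ f O * Real.exp (-(c G / B)) * Real.exp (-a) :=
        mul_le_mul_of_nonneg_right hgap (Real.exp_pos _).le
    _ = _ := by rw [h3, Real.exp_add, mul_assoc]

omit [Fintype V] in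
-- The invariants are that no element of `O` has been rejected yet (`O \ G ⊆ C`) and that the gap
-- has decayed exponentially in the cost spent. Rejecting elements outside `O` keeps both. Either
-- all of `O` ends up in `H`, or the first rejected element of `O` is the witness `x`.
theorem GreedyLoop.guarantee {f c : Finset V → ℝ} {B : ℝ} {N O : Finset V} (hB0 : 0 ≤ B)
    (hf : Monotone f) (hO : 0 ≤ f O)
    (hsum : ∀ G, f O - f G ≤ ∑ y ∈ O \ G, (f (insert y G) - f G))
    (hins : ∀ G x, f (insert x G) ≤ f G + f {x})
    (hc : ∀ X ⊆ N, ∀ x ∈ N, x ∉ X → c X ≤ c (insert x X))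
    (hcost : ∀ G ⊆ N, ∑ y ∈ O \ G, (c (insert y G) - c G) ≤ B)
    (hON : O ⊆ N) {G C H : Finset V} (h : GreedyLoop f c B G C H) (hG : G ⊆ N) (hC : C ⊆ N)
    (hdis : Disjoint G C) (hOC : O \ G ⊆ C) (hcG : c G ≤ B)
    (hgap : 0 < B → f O - f G ≤ f O * Real.exp (-(c G / B))) :
    f O ≤ f H ∨ ∃ x ∈ O, (1 - 1 / Real.exp 1) * f O ≤ f H + f {x} := by
  induction h with
  | done G =>
    exact Or.inl (hf (Finset.sdiff_eq_empty_iff_subset.1 (Finset.subset_empty.1 hOC)))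
  | take G C H x hx hB _ ih =>
    have hxG : x ∉ G := Finset.disjoint_right.1 hdis hx.1
    refine ih (Finset.insert_subset (hC hx.1) hG) ((Finset.erase_subset x C).trans hC)
      (Finset.disjoint_insert_left.2 ⟨Finset.notMem_erase x C,
        hdis.mono_right (Finset.erase_subset x C)⟩) ?_ hB fun hBpos => ?_
    · intro y hy
      simp only [Finset.mem_sdiff, Finset.mem_insert, not_or] at hy
      exact Finset.mem_erase.2 ⟨hy.2.1, hOC (Finset.mem_sdiff.2 ⟨hy.1, hy.2.2⟩)⟩
    · exact gap_insert_le hBpos hO (hf (Finset.subset_insert x G)) hx hOC (hsum G)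
        (hcost G hG) (hc G hG x (hC hx.1) hxG) (hgap hBpos)
  | skip G C H x hx hB hloop ih =>
    have hxG : x ∉ G := Finset.disjoint_right.1 hdis hx.1
    by_cases hxO : x ∈ O
    · refine Or.inr ⟨x, hxO, ?_⟩
      have hmono := hf hloop.subset
      rcases hB0.eq_or_lt with rfl | hBpos
      -- For `B = 0` the exponential bound is unavailable, but elements of `O` then have no marginal
      -- cost and cannot be rejected.
      · have hxcost : c (insert x G) - c G ≤ 0 := by
          refine le_trans (Finset.single_le_sum (f := fun y => c (insert y G) - c G) ?_
            (Finset.mem_sdiff.2 ⟨hxO, hxG⟩)) (hcost G hG)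
          intro y hy
          exact sub_nonneg.2 (hc G hG y (hON (Finset.mem_sdiff.1 hy).1) (Finset.mem_sdiff.1 hy).2)
        linarith
      have h1 := gap_insert_le hBpos hO (hf (Finset.subset_insert x G)) hx hOC (hsum G)
        (hcost G hG) (hc G hG x (hC hx.1) hxG) (hgap hBpos)
      -- The rejected `x` overshoots the budget, so the decay exponent is at least one for the
      -- virtual set `insert x G`.
      have h2 : Real.exp (-(c (insert x G) / B)) ≤ 1 / Real.exp 1 := by
        rw [one_div, ← Real.exp_neg]
        exact Real.exp_le_exp.2 (neg_le_neg ((one_le_div hBpos).2 hB.le))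
      have h3 := mul_le_mul_of_nonneg_left h2 hO
      have h4 := hins G x
      linarith
    · refine ih hG ((Finset.erase_subset x C).trans hC)
        (hdis.mono_right (Finset.erase_subset x C)) ?_ hcG hgap
      intro y hy
      exact Finset.mem_erase.2 ⟨fun h => hxO (h ▸ (Finset.mem_sdiff.1 hy).1), hOC hy⟩

/-! ### The cost-benefit algorithm -/

namespace RoutePlanner.HasParams

variable {I : GTOP V m n q} {k : Fin m} {P : I.RoutePlanner k} {ψ α δ : ℝ}

theorem cost_empty (h : P.HasParams ψ α δ) : P.cost ∅ = 0 := by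
  have h1 := h.approx ∅ (Finset.empty_subset _) _ (I.inRegion_nil k) (Finset.empty_subset _)
  rw [tourLength_nil, mul_zero] at h1
  exact le_antisymm h1 (I.tourLength_nonneg _)

theorem cost_le_insert (h : P.HasParams ψ α δ) (X : Finset V) (hX : X ⊆ I.ground k) (x : V)
    (hx : x ∈ I.ground k) (hxX : x ∉ X) : P.cost X ≤ P.cost (insert x X) :=
  sub_nonneg.1 ((mul_nonneg h.delta_nonneg (I.tourLength_nonneg _)).trans
    (h.lower X hX x hx hxX))

theorem cost_add_sum_le (h : P.HasParams ψ α δ) (X Y : Finset V) (hX : X ⊆ I.ground k)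
    (hY : Y ⊆ I.ground k) (hdis : Disjoint X Y) :
    P.cost X + δ * ∑ y ∈ Y, P.cost {y} ≤ P.cost (X ∪ Y) := by
  induction Y using Finset.induction_on with
  | empty => simp
  | insert y Y hy ih =>
    have hdis' := Finset.disjoint_insert_right.1 hdis
    have hYg := (Finset.subset_insert y Y).trans hY
    have h1 := ih hYg hdis'.2
    have h2 := h.lower (X ∪ Y) (Finset.union_subset hX hYg) y
      (hY (Finset.mem_insert_self y Y)) (by simp [hdis'.1, hy])
    rw [Finset.sum_insert hy, Finset.union_insert]
    linarith

/-- Build `O` from its most expensive vertex `x`: with `s` the sum of single costs, the cost of `O`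
is at least `(1 - δ) * cost {x} + δ * s`, and `cost {x}` is at least the average `s / K`. -/
theorem sum_cost_le (h : P.HasParams ψ α δ) {O : Finset V} (hO : O ⊆ I.ground k) {K : ℕ}
    (hK : O.card ≤ K) :
    (1 + ((K : ℝ) - 1) * δ) * ∑ x ∈ O, P.cost {x} ≤ K * P.cost O := by
  rcases O.eq_empty_or_nonempty with rfl | hne
  · simp [h.cost_empty]
  obtain ⟨x, hx, hmax⟩ := O.exists_max_image (fun x => P.cost {x}) hne
  have h1 := h.cost_add_sum_le {x} (O.erase x) (Finset.singleton_subset_iff.2 (hO hx))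
    ((Finset.erase_subset x O).trans hO)
    (Finset.disjoint_singleton_left.2 (Finset.notMem_erase x O))
  have h2 : {x} ∪ O.erase x = O := by rw [← Finset.insert_eq, Finset.insert_erase hx]
  rw [h2] at h1
  have h3 := Finset.add_sum_erase O (fun x => P.cost {x}) hx
  have h4 : ∑ y ∈ O, P.cost {y} ≤ K * P.cost {x} := by
    refine (Finset.sum_le_card_nsmul O _ _ hmax).trans ?_
    rw [nsmul_eq_mul]
    exact mul_le_mul_of_nonneg_right (Nat.cast_le.2 hK) (I.tourLength_nonneg _)
  have h5 := mul_le_mul_of_nonneg_left h4 (sub_nonneg.2 h.delta_le_one)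
  have h6 := mul_le_mul_of_nonneg_left h1 (Nat.cast_nonneg (α := ℝ) K)
  have h7 : ∑ y ∈ O.erase x, P.cost {y} = ∑ y ∈ O, P.cost {y} - P.cost {x} := by
    rw [← h3]
    ring
  rw [h7] at h6
  linarith

end RoutePlanner.HasParams

theorem one_le_maxVisits (I : GTOP V m n q) (k : Fin m) : 1 ≤ I.maxVisits k := by
  classical
  have hreg := I.inRegion_nil k
  refine le_trans (b := ({I.depot k} : Finset V).card) (by simp)
    (Finset.le_sup (f := Finset.card) ?_)
  simp only [Finset.mem_filter, Finset.mem_powerset, Finset.singleton_subset_iff]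
  exact ⟨I.verts_subset_ground hreg (I.depot_mem_verts _), _, hreg, I.depot_mem_verts _,
    (I.tourLength_nil k).trans_le (I.budget_nonneg k)⟩

theorem card_verts_le_maxVisits (I : GTOP V m n q) {k : Fin m} {t : I.Tour k}
    (ht : I.InRegion t) (hl : I.tourLength t ≤ I.budget k) :
    (I.verts t).card ≤ I.maxVisits k := by
  classical
  refine Finset.le_sup (f := Finset.card) ?_
  simp only [Finset.mem_filter, Finset.mem_powerset]
  exact ⟨I.verts_subset_ground ht, t, ht, subset_rfl, hl⟩

/-- The costs of the single vertices of a tour within the reduced budget sum up to at most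
`α` times the budget. -/
theorem sum_cost_verts_le (I : GTOP V m n q) {k : Fin m} {P : I.RoutePlanner k}
    {ψ α δ : Fin m → ℝ} (h : P.HasParams (ψ k) (α k) (δ k)) {t : I.Tour k} (ht : I.InRegion t)
    (hl : I.tourLength t ≤ I.reducedBudget ψ α δ k) :
    ∑ x ∈ I.verts t, P.cost {x} ≤ α k * I.budget k := by
  have hK : (1 : ℝ) ≤ I.maxVisits k := by exact_mod_cast I.one_le_maxVisits k
  have hψ := h.one_le
  have hB := I.budget_nonneg k
  set K : ℝ := (I.maxVisits k : ℝ)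
  set D : ℝ := 1 + (K - 1) * δ k
  have hDpos : 0 < D := by
    have : 0 ≤ (K - 1) * δ k := mul_nonneg (sub_nonneg.2 hK) h.delta_nonneg
    linarith
  have hDK : D ≤ K := by
    have : (K - 1) * δ k ≤ (K - 1) * 1 := mul_le_mul_of_nonneg_left h.delta_le_one (sub_nonneg.2 hK)
    linarith
  have hKψ : 0 < ψ k * K := by positivity
  have hred : I.reducedBudget ψ α δ k = α k * D / (ψ k * K) * I.budget k := rfl
  have hl' : ψ k * K * I.tourLength t ≤ α k * D * I.budget k := by
    have := mul_le_mul_of_nonneg_left hl hKψ.le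
    refine this.trans_eq ?_
    rw [hred]
    field_simp
  -- `maxVisits` controls only tours within the full budget, so the reduced budget must first be
  -- seen not to exceed it.
  have hbud : I.tourLength t ≤ I.budget k := by
    refine hl.trans ?_
    rw [hred]
    refine mul_le_of_le_one_left hB ((div_le_one hKψ).2 ?_)
    calc α k * D ≤ 1 * K := mul_le_mul h.alpha_le_one hDK hDpos.le zero_le_one
      _ ≤ ψ k * K := mul_le_mul_of_nonneg_right hψ (by linarith)
  have h1 := h.sum_cost_le (I.verts_subset_ground ht) (I.card_verts_le_maxVisits ht hbud)
  have h2 := mul_le_mul_of_nonneg_left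
    (h.approx _ (I.verts_subset_ground ht) t ht subset_rfl) (zero_le_one.trans hK)
  refine le_of_mul_le_mul_left ?_ hDpos
  calc D * ∑ x ∈ I.verts t, P.cost {x} ≤ K * P.cost (I.verts t) := h1
    _ ≤ K * (ψ k * I.tourLength t) := h2
    _ = ψ k * K * I.tourLength t := by ring
    _ ≤ α k * D * I.budget k := hl'
    _ = _ := by ring

theorem costBenefit_isBicriterionSingle (I : GTOP V m n q) (P : ∀ k, I.RoutePlanner k)
    (ψ α δ : Fin m → ℝ) (hP : ∀ k, (P k).HasParams (ψ k) (α k) (δ k)) :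
    I.IsBicriterionSingle orienteeringFactor I.budget (I.reducedBudget ψ α δ)
      (I.CostBenefit P) := by
  rintro k φ t ⟨a, G, S, ⟨ha, haB, hamax⟩, hG, hS, haS, hGS, rfl⟩
  have h := hP k
  have hB := I.budget_nonneg k
  have hGg : G ⊆ I.ground k := by simpa using hG.subset_union
  have hSg : S ⊆ I.ground k := by
    rcases hS with rfl | rfl
    · exact Finset.singleton_subset_iff.2 ha
    · exact hGg
  have hc0 : (P k).cost ∅ ≤ I.budget k := h.cost_empty.trans_le hB
  refine ⟨(P k).inRegion S hSg, ?_, fun t' ht' hl' => ?_⟩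
  · rcases hS with rfl | rfl
    · exact haB
    · exact hG.cost_le hc0
  set O := I.verts t'
  have hOg : O ⊆ I.ground k := I.verts_subset_ground ht'
  have hsum : ∑ x ∈ O, (P k).cost {x} ≤ α k * I.budget k := I.sum_cost_verts_le h ht' hl'
  have hnn : ∀ X, 0 ≤ I.residual φ X := fun X =>
    (I.residual_empty φ).symm.trans_le (I.residual_mono φ (Finset.empty_subset X))
  have hcost : ∀ G ⊆ I.ground k,
      ∑ y ∈ O \ G, ((P k).cost (insert y G) - (P k).cost G) ≤ I.budget k := by
    intro G hG
    refine le_of_mul_le_mul_left ?_ h.alpha_pos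
    rw [Finset.mul_sum]
    refine le_trans (Finset.sum_le_sum fun y hy => ?_)
      ((Finset.sum_le_sum_of_subset_of_nonneg (Finset.sdiff_subset (s := O) (t := G))
        fun y _ _ => I.tourLength_nonneg _).trans hsum)
    exact h.upper G hG y (hOg (Finset.mem_sdiff.1 hy).1) (Finset.mem_sdiff.1 hy).2
  have he : 1 / Real.exp 1 < 1 := (div_lt_one (Real.exp_pos 1)).2 (by simp)
  have hpos : 0 < 1 - 1 / Real.exp 1 := sub_pos.2 he
  -- The planned route may pass through further vertices; by monotonicity these only help.
  have hout : I.residual φ S ≤ I.residual φ (I.verts ((P k).route S)) :=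
    I.residual_mono φ ((P k).covers S hSg)
  suffices hmain : (1 - 1 / Real.exp 1) * I.residual φ O ≤ 2 * I.residual φ S by
    rw [orienteeringFactor, mul_right_comm, ← div_eq_mul_inv, le_div_iff₀ hpos]
    linarith
  rcases hG.guarantee hB (I.residual_mono φ) (hnn O) (fun G => I.residual_sub_le_sum φ G O)
    (I.residual_insert_le φ) h.cost_le_insert hcost hOg (Finset.empty_subset _) subset_rfl
    (Finset.disjoint_empty_left _) (by simpa using hOg) hc0
    (fun _ => by simp [h.cost_empty, I.residual_empty]) with h1 | ⟨x, hx, h1⟩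
  · have h2 : (1 - 1 / Real.exp 1) * I.residual φ O ≤ 1 * I.residual φ O :=
      mul_le_mul_of_nonneg_right (sub_le_self 1 (by positivity)) (hnn O)
    linarith [hnn S]
  -- The rejected vertex is affordable on its own, so its reward is at most that of `a`.
  · have hxB : (P k).cost {x} ≤ I.budget k :=
      (Finset.single_le_sum (f := fun x => (P k).cost {x})
        (fun y _ => I.tourLength_nonneg _) hx).trans
        (hsum.trans (mul_le_of_le_one_left hB h.alpha_le_one))
    linarith [hamax x (hOg hx) hxB]

theorem exists_costBenefit (I : GTOP V m n q) (P : ∀ k, I.RoutePlanner k) {k : Fin m}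
    {ψ α δ : ℝ} (h : (P k).HasParams ψ α δ) (φ : Fin n → ℕ) : ∃ t, I.CostBenefit P k φ t := by
  classical
  have hnil := I.inRegion_nil k
  have hdg : I.depot k ∈ I.ground k := I.verts_subset_ground hnil (I.depot_mem_verts _)
  -- The depot costs nothing, being covered by the trivial tour, so an affordable single vertex
  -- always exists.
  have hd : (P k).cost {I.depot k} ≤ I.budget k := by
    have := h.approx {I.depot k} (Finset.singleton_subset_iff.2 hdg) _ hnil
      (Finset.singleton_subset_iff.2 (I.depot_mem_verts _))
    rw [tourLength_nil, mul_zero] at this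
    exact this.trans (I.budget_nonneg k)
  obtain ⟨a, ha, hmax⟩ := ((I.ground k).filter
    fun x => (P k).cost {x} ≤ I.budget k).exists_max_image (fun x => I.residual φ {x})
    ⟨_, Finset.mem_filter.2 ⟨hdg, hd⟩⟩
  rw [Finset.mem_filter] at ha
  obtain ⟨G, hG⟩ := exists_greedyLoop (B := I.budget k) (I.residual_mono φ) h.cost_le_insert
    (I.ground k) ∅ (Finset.empty_subset _) subset_rfl (Finset.disjoint_empty_left _)
  have ha' : a ∈ I.ground k ∧ (P k).cost {a} ≤ I.budget k ∧
      ∀ b ∈ I.ground k, (P k).cost {b} ≤ I.budget k → I.residual φ {b} ≤ I.residual φ {a} :=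
    ⟨ha.1, ha.2, fun b hb hbB => hmax b (Finset.mem_filter.2 ⟨hb, hbB⟩)⟩
  rcases le_total (I.residual φ {a}) (I.residual φ G) with hle | hle
  · exact ⟨_, a, G, G, ha', hG, Or.inr rfl, hle, le_rfl, rfl⟩
  · exact ⟨_, a, G, {a}, ha', hG, Or.inl rfl, le_rfl, hle, rfl⟩

end GTOP

theorem mainTheorem6 {V : Type*} [Fintype V] [DecidableEq V] {m n q : ℕ} (I : GTOP V m n q) :
    (∀ (P : ∀ k, I.RoutePlanner k) (ψ α δ : Fin m → ℝ),
      (∀ k, (P k).HasParams (ψ k) (α k) (δ k)) →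
        I.IsBicriterionSingle orienteeringFactor I.budget (I.reducedBudget ψ α δ)
          (I.CostBenefit P) ∧
        (∃ T : ∀ k, I.Tour k, I.IsSequentialOutput (I.CostBenefit P) T) ∧
        ∀ T : ∀ k, I.Tour k, I.IsSequentialOutput (I.CostBenefit P) T →
          I.IsBicriterionTeam (1 + orienteeringFactor) I.budget (I.reducedBudget ψ α δ) T) ∧
    (∀ k, ∃ P : I.RoutePlanner k, P.HasParams 1 1 0) ∧
    (∀ (S : ∀ k, (Fin n → ℕ) → I.Tour k → Prop) (U b : Fin m → ℝ),
      I.IsBicriterionSingle orienteeringFactor U b S →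
        ∀ T : ∀ k, I.Tour k, I.IsSequentialOutput S T →
          I.IsBicriterionTeam (1 + orienteeringFactor) U b T) := by
  refine ⟨fun P ψ α δ hP => ?_, I.exists_routePlanner, fun S U b hS T hT =>
    I.isBicriterionTeam_of_single hS hT⟩
  have h := I.costBenefit_isBicriterionSingle P ψ α δ hP
  exact ⟨h, I.exists_isSequentialOutput fun k φ => I.exists_costBenefit P (hP k) φ,
    fun T hT => I.isBicriterionTeam_of_single h hT⟩
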